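/- Let $\xi\in(0,1)$ be irrational with regular continued fraction $\xi=[0;a_1,a_2,\dots]$, and let $q_0=1$, $q_1=a_1$, $q_{i+2}=a_{i+2}q_{i+1}+q_i$ be the denominators of its convergents. Suppose that $\xi$ is a BR-number, i.e. every odd partial quotient $a_{2k+1}$ ($k\ge 0$) is even; equivalently, every $q_{2k+1}$ is even. For a real number $x$ and an integer $m\ge 0$ put $S_m(x)=\sum_{j=1}^m(-1)^{\lfloor jx\rfloor}$ (so $S_0(x)=0$), and call $N\ge 0$ a record of the walk $S(2\xi)$ if $S_m(2\xi)\ne S_N(2\xi)$ for all $0\le m<N$. Let $N\ge 0$ be an integer and let $N=\sum_{i=0}^n b_iq_i$ be its $\xi$-Ostrowski representation, with $n$ the index of the most significant digit: the $b_i$ are non-negative integers with $b_0<a_1$, $b_i\le a_{i+1}$ for $1\le i\le n$, $b_{i-1}=0$ whenever $1\le i\le n$ and $b_i=a_{i+1}$, and $b_n\ne 0$ unless $n=0$. Then $N$ is a record of the walk $S(2\xi)$ if and only if all of the following hold: $n$ is even; $b_i=0$ for every odd $i\le n$; $b_i=a_{i+1}/2$ for every even $i<n$; and $b_n\le a_{n+1}/2$.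 -/

import Mathlib

namespace DetWalk

/-- The partial quotients `a_n` of the regular continued fraction `[a_0; a_1, a_2, …]` of `ξ`
(with the value `0` after termination, which does not happen for irrational `ξ`). -/
noncomputable def partialQuotient (ξ : ℝ) (n : ℕ) : ℤ :=
  ((GenContFract.IntFractPair.stream ξ n).map fun p => p.b).getD 0

/-- The denominators `q_n` of the convergents `p_n / q_n = [a_0; a_1, …, a_n]` of `ξ`:
`q_0 = 1`, `q_1 = a_1`, `q_{n+2} = a_{n+2} q_{n+1} + q_n`. -/
noncomputable def convDenom (ξ : ℝ) : ℕ → ℤ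
  | 0 => 1
  | 1 => partialQuotient ξ 1
  | n + 2 => partialQuotient ξ (n + 2) * convDenom ξ (n + 1) + convDenom ξ n

/-- `ξ` is a BR-number: all its odd partial quotients `a_{2n+1}` are even. For irrational `ξ`, which
has infinitely many partial quotients, this says that all `q_{2n+1}` are even; see
`isBR_iff_even_convDenom`. -/
def IsBR (ξ : ℝ) : Prop := ∀ n : ℕ, Even (partialQuotient ξ (2 * n + 1))

/-- The deterministic random walk `S_n(x) = ∑_{j=1}^n (-1)^⌊j x⌋`. -/
noncomputable def walk (x : ℝ) (n : ℕ) : ℤ :=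
  ∑ j ∈ Finset.Icc 1 n, (((-1 : ℤˣ) ^ ⌊(j : ℝ) * x⌋ : ℤˣ) : ℤ)

/-- `r` is a record of the walk `S_n(x)`: the value `S_r(x)` is not taken at any earlier index,
index `0` included. -/
def IsRecord (x : ℝ) (r : ℕ) : Prop := ∀ m < r, walk x m ≠ walk x r

/-- `N = ∑_{i=0}^n b_i q_i` is the `ξ`-Ostrowski representation of `N`, where `n` is the index of
the most significant digit: `b_n ≠ 0` unless `n = 0` (so that `N = 0` is represented by `n = 0`,
`b_0 = 0`). Only the digits `b_0, …, b_n` matter. -/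
structure IsOstrowskiRep (ξ : ℝ) (N n : ℕ) (b : ℕ → ℕ) : Prop where
  zero_lt : (b 0 : ℤ) < partialQuotient ξ 1
  digit_le : ∀ i, 1 ≤ i → i ≤ n → (b i : ℤ) ≤ partialQuotient ξ (i + 1)
  carry : ∀ i, 1 ≤ i → i ≤ n → (b i : ℤ) = partialQuotient ξ (i + 1) → b (i - 1) = 0
  lead_ne_zero : 0 < n → b n ≠ 0
  sum_eq : (N : ℤ) = ∑ i ∈ Finset.range (n + 1), (b i : ℤ) * convDenom ξ i

/-! Sanity checks: the definitions above agree with Mathlib's continued fractions, the two usual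
definitions of BR-numbers agree, and every natural number has an Ostrowski representation. -/

theorem stream_eq_some {ξ : ℝ} (hξ : Irrational ξ) (n : ℕ) :
    ∃ p, GenContFract.IntFractPair.stream ξ n = some p ∧ p.b = partialQuotient ξ n := by
  cases h : GenContFract.IntFractPair.stream ξ n with
  | some p => exact ⟨p, rfl, by simp [partialQuotient, h]⟩
  | none =>
    exfalso
    have h1 : GenContFract.IntFractPair.stream ξ (n + 1) = none :=
      GenContFract.IntFractPair.succ_nth_stream_eq_none_iff.mpr (Or.inl h)
    have h2 := GenContFract.of_terminatedAt_n_iff_succ_nth_intFractPair_stream_eq_none.mpr h1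
    obtain ⟨q, hq⟩ := (GenContFract.terminates_iff_rat ξ).mp ⟨n, h2⟩
    exact hξ ⟨q, hq.symm⟩

theorem get?_of {ξ : ℝ} (hξ : Irrational ξ) (n : ℕ) :
    (GenContFract.of ξ).s.get? n = some ⟨1, (partialQuotient ξ (n + 1) : ℝ)⟩ := by
  obtain ⟨p, hp, hb⟩ := stream_eq_some hξ (n + 1)
  rw [GenContFract.get?_of_eq_some_of_succ_get?_intFractPair_stream hp, hb]

theorem convDenom_eq_dens {ξ : ℝ} (hξ : Irrational ξ) (n : ℕ) :
    (convDenom ξ n : ℝ) = (GenContFract.of ξ).dens n := by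
  induction n using Nat.twoStepInduction with
  | zero => simp [convDenom]
  | one => rw [GenContFract.first_den_eq (get?_of hξ 0)]; simp [convDenom]
  | more n h0 h1 =>
    rw [GenContFract.dens_recurrence (get?_of hξ (n + 1)) h0.symm h1.symm]
    simp [convDenom]

theorem one_le_partialQuotient {ξ : ℝ} (hξ : Irrational ξ) (n : ℕ) :
    1 ≤ partialQuotient ξ (n + 1) := by
  obtain ⟨p, hp, hb⟩ := stream_eq_some hξ (n + 1)
  rw [← hb]
  exact GenContFract.IntFractPair.one_le_succ_nth_stream_b hp

theorem isBR_iff_even_convDenom (ξ : ℝ) : IsBR ξ ↔ ∀ n : ℕ, Even (convDenom ξ (2 * n + 1)) := by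
  have step : ∀ n, convDenom ξ (2 * n + 3) =
      partialQuotient ξ (2 * n + 3) * convDenom ξ (2 * n + 2) + convDenom ξ (2 * n + 1) :=
    fun n => rfl
  have step' : ∀ n, convDenom ξ (2 * n + 2) =
      partialQuotient ξ (2 * n + 2) * convDenom ξ (2 * n + 1) + convDenom ξ (2 * n) :=
    fun n => rfl
  constructor
  · intro h n
    induction n with
    | zero => exact h 0
    | succ n ih =>
      have := h (n + 1)
      rw [show 2 * (n + 1) + 1 = 2 * n + 3 by ring] at this ⊢
      rw [step]
      exact (this.mul_right _).add ih
  · intro h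
    have hodd : ∀ n, Odd (convDenom ξ (2 * n)) := by
      intro n
      induction n with
      | zero => exact odd_one
      | succ n ih =>
        rw [show 2 * (n + 1) = 2 * n + 2 by ring, step']
        exact ((h n).mul_left _).add_odd ih
    intro n
    cases n with
    | zero => exact h 0
    | succ n =>
      have h1 := h (n + 1)
      have h2 := hodd (n + 1)
      rw [show 2 * (n + 1) + 1 = 2 * n + 3 by ring] at h1 ⊢
      rw [show 2 * (n + 1) = 2 * n + 2 by ring] at h2
      rw [step, Int.even_add] at h1
      have h3 := h1.mpr (h n)
      rw [Int.even_mul] at h3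
      exact h3.resolve_right (Int.not_even_iff_odd.mpr h2)

theorem convDenom_pos {ξ : ℝ} (hξ : Irrational ξ) (n : ℕ) : 1 ≤ convDenom ξ n := by
  induction n using Nat.twoStepInduction with
  | zero => simp [convDenom]
  | one => exact one_le_partialQuotient hξ 0
  | more n h0 h1 =>
    have := one_le_partialQuotient hξ (n + 1)
    simp only [convDenom]
    nlinarith

theorem le_convDenom {ξ : ℝ} (hξ : Irrational ξ) (n : ℕ) : (n : ℤ) + 1 ≤ convDenom ξ (n + 1) := by
  induction n with
  | zero => exact convDenom_pos hξ 1
  | succ n ih =>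
    have h1 := one_le_partialQuotient hξ (n + 1)
    have h2 := convDenom_pos hξ n
    simp only [convDenom]
    push_cast
    nlinarith

theorem exists_digits {ξ : ℝ} (hξ : Irrational ξ) (n : ℕ) :
    ∀ N : ℕ, (N : ℤ) < convDenom ξ (n + 1) → ∃ b : ℕ → ℕ,
      (b n : ℤ) = N / convDenom ξ n ∧ (b 0 : ℤ) < partialQuotient ξ 1 ∧
      (∀ i, 1 ≤ i → i ≤ n → (b i : ℤ) ≤ partialQuotient ξ (i + 1)) ∧
      (∀ i, 1 ≤ i → i ≤ n → (b i : ℤ) = partialQuotient ξ (i + 1) → b (i - 1) = 0) ∧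
      (N : ℤ) = ∑ i ∈ Finset.range (n + 1), (b i : ℤ) * convDenom ξ i := by
  induction n with
  | zero =>
    intro N hN
    exact ⟨fun _ => N, by simp [convDenom], hN, by omega, by omega, by simp [convDenom]⟩
  | succ n ih =>
    intro N hN
    have hq := convDenom_pos hξ (n + 1)
    have hq0 := convDenom_pos hξ n
    have hr0 : 0 ≤ (N : ℤ) % convDenom ξ (n + 1) := Int.emod_nonneg _ (by omega)
    have hr1 : (N : ℤ) % convDenom ξ (n + 1) < convDenom ξ (n + 1) :=
      Int.emod_lt_of_pos _ (by omega)
    have hd0 : 0 ≤ (N : ℤ) / convDenom ξ (n + 1) := Int.ediv_nonneg (by omega) (by omega)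
    have hdm := Int.mul_ediv_add_emod (N : ℤ) (convDenom ξ (n + 1))
    have hrec : convDenom ξ (n + 1 + 1) =
      partialQuotient ξ (n + 2) * convDenom ξ (n + 1) + convDenom ξ n := rfl
    have hmono : convDenom ξ n ≤ convDenom ξ (n + 1) := by
      cases n with
      | zero => exact hq
      | succ m =>
        have h1 := one_le_partialQuotient hξ (m + 1)
        have h2 := convDenom_pos hξ m
        have h3 : convDenom ξ (m + 1 + 1) =
          partialQuotient ξ (m + 2) * convDenom ξ (m + 1) + convDenom ξ m := rfl
        nlinarith
    obtain ⟨r, hr⟩ := Int.eq_ofNat_of_zero_le hr0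
    obtain ⟨d, hd⟩ := Int.eq_ofNat_of_zero_le hd0
    rw [hr] at hr1 hdm
    rw [hd] at hdm
    obtain ⟨b, hbn, hb0, hble, hbc, hbs⟩ := ih r hr1
    have hupd : ∀ i, i ≤ n → Function.update b (n + 1) d i = b i := fun i hi =>
      Function.update_of_ne (by omega) _ _
    refine ⟨Function.update b (n + 1) d, ?_, ?_, ?_, ?_, ?_⟩
    · rw [Function.update_self, hd]
    · rw [hupd 0 (by omega)]; exact hb0
    · intro i hi1 hi2
      rcases Nat.lt_or_ge n i with h | h
      · obtain rfl : i = n + 1 := by omega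
        rw [Function.update_self]
        by_contra hcon
        push Not at hcon
        have : partialQuotient ξ (n + 2) + 1 ≤ (d : ℤ) := hcon
        nlinarith
      · rw [hupd i h]; exact hble i hi1 h
    · intro i hi1 hi2 hi
      rcases Nat.lt_or_ge n i with h | h
      · obtain rfl : i = n + 1 := by omega
        rw [Function.update_self] at hi
        rw [Nat.add_sub_cancel, hupd n le_rfl]
        have hi' : (d : ℤ) = partialQuotient ξ (n + 2) := hi
        have hlt : (r : ℤ) < convDenom ξ n := by
          rw [hi'] at hdm
          linarith [mul_comm (convDenom ξ (n + 1)) (partialQuotient ξ (n + 2))]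
        rw [Int.ediv_eq_zero_of_lt (by omega) hlt] at hbn
        exact_mod_cast hbn
      · rw [hupd i h] at hi
        rw [hupd (i - 1) (by omega)]
        exact hbc i hi1 h hi
    · rw [Finset.sum_range_succ, Function.update_self, Finset.sum_congr rfl
        (fun i hi => by rw [hupd i (by simpa [Nat.lt_succ_iff] using hi)]), ← hbs, ← hdm]
      ring

theorem exists_isOstrowskiRep {ξ : ℝ} (hξ : Irrational ξ) (N : ℕ) :
    ∃ n b, IsOstrowskiRep ξ N n b := by
  classical
  have hex : ∃ n, (N : ℤ) < convDenom ξ (n + 1) := ⟨N, by linarith [le_convDenom hξ N]⟩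
  obtain ⟨b, hbn, hb0, hble, hbc, hbs⟩ := exists_digits hξ (Nat.find hex) N (Nat.find_spec hex)
  refine ⟨Nat.find hex, b, hb0, hble, hbc, fun hpos hz => ?_, hbs⟩
  have h1 := Nat.find_min hex (Nat.sub_lt hpos one_pos)
  rw [show Nat.find hex - 1 + 1 = Nat.find hex by omega] at h1
  push Not at h1
  have h2 := convDenom_pos hξ (Nat.find hex)
  have h3 : 1 ≤ (N : ℤ) / convDenom ξ (Nat.find hex) := by
    rw [Int.le_ediv_iff_mul_le (by omega)]; linarith
  rw [← hbn, hz] at h3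
  norm_num at h3

end DetWalk

/-! Write `D_n = (-1)^n (q_n ξ - p_n)`; these errors are positive and decreasing. The BR condition
makes `q_{2k+1}` even and `q_{2k}` odd. This parity gives the increments of `S(2ξ)` three
symmetries: invariance under shifts by `q_{2k}` in the first half of `[0, q_{2k+1}]`
(`walkStep_add_even`), antisymmetry about `q_{2k+1}/2` (`walkStep_reflect`), and invariance under
shifts by `q_{2k+1}` up to `q_{2k+2}` (`walkStep_add_odd`). Hence `S(q_{2k}) = 1` and `S(q_{2k+1}) =
0`. Up to `q_{2k+1}/2` the walk climbs by 1 per block of length `q_{2k}`; it then retraces its path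
and repeats up to `q_{2k+2}` without a new maximum. By induction (`walkBounds`) it is nonnegative,
and its records are exactly `q_{2k-1}/2 + b q_{2k}` with `b ≤ a_{2k+1}/2`, of value `∑_{i<k}
a_{2i+1}/2 + b`. Since `q_{2k-1}/2 = ∑_{i<k} (a_{2i+1}/2) q_{2i}`, these numbers have the asserted
digits, and uniqueness of Ostrowski representations finishes the proof. -/

namespace DetWalk

/-! ### Convergents and their approximation errors -/

/-- The numerators `p_n` of the convergents of `ξ ∈ (0, 1)`. -/
noncomputable def convNum (ξ : ℝ) : ℕ → ℤ
  | 0 => 0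
  | 1 => 1
  | n + 2 => partialQuotient ξ (n + 2) * convNum ξ (n + 1) + convNum ξ n

/-- The signed approximation error `(-1)^n (q_n ξ - p_n)`. -/
noncomputable def convErr (ξ : ℝ) (n : ℕ) : ℝ :=
  (-1) ^ n * (convDenom ξ n * ξ - convNum ξ n)

theorem convErr_add_two (ξ : ℝ) (n : ℕ) :
    convErr ξ (n + 2) = convErr ξ n - partialQuotient ξ (n + 2) * convErr ξ (n + 1) := by
  simp only [convErr, convDenom, convNum]
  push_cast
  ring

/-- The ratio of consecutive errors is the remainder in the continued fraction algorithm, which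
irrationality keeps away from 0. -/
theorem convErr_eq_fr_mul {ξ : ℝ} (hξ : Irrational ξ) (h0 : 0 < ξ) (h1 : ξ < 1) (n : ℕ) :
    0 < convErr ξ n ∧ ∃ p, GenContFract.IntFractPair.stream ξ (n + 1) = some p ∧
      0 < p.fr ∧ p.fr < 1 ∧ convErr ξ (n + 1) = convErr ξ n * p.fr := by
  have fr_lt : ∀ m p, GenContFract.IntFractPair.stream ξ m = some p → 0 < p.fr ∧ p.fr < 1 := by
    intro m p hp
    have h := GenContFract.IntFractPair.nth_stream_fr_nonneg_lt_one hp
    refine ⟨lt_of_le_of_ne h.1 fun h0 => ?_, h.2⟩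
    have h2 : GenContFract.IntFractPair.stream ξ (m + 1) = none :=
      GenContFract.IntFractPair.succ_nth_stream_eq_none_iff.mpr (Or.inr ⟨p, hp, h0.symm⟩)
    obtain ⟨p', hp', _⟩ := stream_eq_some hξ (m + 1)
    simp [h2] at hp'
  have succ_fr : ∀ m p p', GenContFract.IntFractPair.stream ξ m = some p →
      GenContFract.IntFractPair.stream ξ (m + 1) = some p' →
      p.fr * p'.fr = 1 - partialQuotient ξ (m + 1) * p.fr := by
    intro m p p' hp hp'
    obtain ⟨r, hr, hr0, hrp⟩ := GenContFract.IntFractPair.succ_nth_stream_eq_some_iff.mp hp'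
    obtain rfl : r = p := by simpa [hr] using hp
    obtain ⟨r', hr', hb⟩ := stream_eq_some hξ (m + 1)
    obtain rfl : r' = p' := by simpa [hr'] using hp'
    rw [← hb, ← hrp]
    simp only [GenContFract.IntFractPair.of, Int.fract]
    field_simp
  induction n with
  | zero =>
    have hs : GenContFract.IntFractPair.stream ξ 0 = some (GenContFract.IntFractPair.of ξ) := rfl
    have hfr : (GenContFract.IntFractPair.of ξ).fr = ξ :=
      Int.fract_eq_self.mpr ⟨h0.le, h1⟩
    obtain ⟨p, hp, _⟩ := stream_eq_some hξ 1
    have := succ_fr 0 _ p hs hp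
    rw [hfr] at this
    refine ⟨by simpa [convErr, convDenom, convNum] using h0, p, hp, (fr_lt _ _ hp).1,
      (fr_lt _ _ hp).2, ?_⟩
    simp only [convErr, convDenom, convNum]
    push_cast
    linarith
  | succ n ih =>
    obtain ⟨hpos, p, hp, hp0, hp1, he⟩ := ih
    obtain ⟨p', hp', _⟩ := stream_eq_some hξ (n + 1 + 1)
    have := succ_fr (n + 1) p p' hp hp'
    refine ⟨by rw [he]; positivity, p', hp', (fr_lt _ _ hp').1, (fr_lt _ _ hp').2, ?_⟩
    rw [convErr_add_two, he, mul_assoc, this]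
    ring

theorem convErr_pos {ξ : ℝ} (hξ : Irrational ξ) (h0 : 0 < ξ) (h1 : ξ < 1) (n : ℕ) :
    0 < convErr ξ n := (convErr_eq_fr_mul hξ h0 h1 n).1

theorem convErr_succ_lt {ξ : ℝ} (hξ : Irrational ξ) (h0 : 0 < ξ) (h1 : ξ < 1) (n : ℕ) :
    convErr ξ (n + 1) < convErr ξ n := by
  obtain ⟨hpos, p, -, -, hp1, he⟩ := convErr_eq_fr_mul hξ h0 h1 n
  rw [he]
  exact mul_lt_of_lt_one_right hpos hp1

theorem convNum_mul_convDenom_sub (ξ : ℝ) (n : ℕ) :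
    convNum ξ (n + 1) * convDenom ξ n - convNum ξ n * convDenom ξ (n + 1) = (-1) ^ n := by
  induction n with
  | zero => simp [convNum, convDenom]
  | succ n ih =>
    simp only [convNum, convDenom]
    rw [pow_succ, ← ih]
    ring

/-- Consecutive convergents form a basis of `ℤ²`. -/
theorem exists_convergent_coords (ξ : ℝ) (n : ℕ) (i l : ℤ) : ∃ u v : ℤ,
    i = u * convDenom ξ n + v * convDenom ξ (n + 1) ∧
    (i * ξ - l : ℝ) = (-1) ^ n * (u * convErr ξ n - v * convErr ξ (n + 1)) := by
  have hdet := convNum_mul_convDenom_sub ξ n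
  have hs : ((-1 : ℤ) ^ n) * (-1) ^ n = 1 := by rw [← mul_pow]; simp
  have hsR : ((-1 : ℝ) ^ n) * (-1) ^ n = 1 := by rw [← mul_pow]; simp
  -- Cramer's rule; the determinant is `(-1)^n`.
  have hi : i = ((-1) ^ n * (i * convNum ξ (n + 1) - l * convDenom ξ (n + 1))) * convDenom ξ n +
      ((-1) ^ n * (l * convDenom ξ n - i * convNum ξ n)) * convDenom ξ (n + 1) := by
    linear_combination (-i * (-1) ^ n) * hdet - i * hs
  have hl : l = ((-1) ^ n * (i * convNum ξ (n + 1) - l * convDenom ξ (n + 1))) * convNum ξ n +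
      ((-1) ^ n * (l * convDenom ξ n - i * convNum ξ n)) * convNum ξ (n + 1) := by
    linear_combination (-l * (-1) ^ n) * hdet - l * hs
  generalize (-1) ^ n * (i * convNum ξ (n + 1) - l * convDenom ξ (n + 1)) = u at hi hl
  generalize (-1) ^ n * (l * convDenom ξ n - i * convNum ξ n) = v at hi hl
  refine ⟨u, v, hi, ?_⟩
  rw [hi, hl]
  simp only [convErr]
  push_cast
  rw [pow_succ]
  linear_combination (-(u : ℝ) * (convDenom ξ n * ξ - convNum ξ n) -
    v * (convDenom ξ (n + 1) * ξ - convNum ξ (n + 1))) * hsR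

/-! ### Increments of the walk -/

/-- The increment `(-1)^⌊j x⌋` of the walk. -/
noncomputable def walkStep (x : ℝ) (j : ℕ) : ℤ := (((-1 : ℤˣ) ^ ⌊(j : ℝ) * x⌋ : ℤˣ) : ℤ)

theorem walk_zero (x : ℝ) : walk x 0 = 0 := by simp [walk]

theorem walk_succ (x : ℝ) (n : ℕ) : walk x (n + 1) = walk x n + walkStep x (n + 1) := by
  simp [walk, walkStep, Finset.sum_Icc_succ_top]

theorem walk_add {x : ℝ} {q m : ℕ}
    (h : ∀ j, 1 ≤ j → j ≤ m → walkStep x (j + q) = walkStep x j) :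
    walk x (m + q) = walk x m + walk x q := by
  induction m with
  | zero => simp [walk_zero]
  | succ m ih =>
    rw [show m + 1 + q = m + q + 1 by ring, walk_succ, walk_succ,
      ih fun j h1 h2 => h j h1 (by omega), ← h (m + 1) (by omega) le_rfl,
      show m + 1 + q = m + q + 1 by ring]
    ring

theorem walkStep_of_floor_even {x : ℝ} {j : ℕ} (h : Even ⌊(j : ℝ) * x⌋) : walkStep x j = 1 := by
  simp [walkStep, h.neg_one_zpow]

theorem walkStep_of_floor_odd {x : ℝ} {j : ℕ} (h : Odd ⌊(j : ℝ) * x⌋) : walkStep x j = -1 := by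
  simp [walkStep, h.neg_one_zpow]

theorem walkStep_congr {x : ℝ} {i j : ℕ} (h : Even (⌊(i : ℝ) * x⌋ - ⌊(j : ℝ) * x⌋)) :
    walkStep x i = walkStep x j := by
  rcases Int.even_or_odd ⌊(j : ℝ) * x⌋ with hj | hj
  · rw [walkStep_of_floor_even hj, walkStep_of_floor_even ((Int.even_sub.mp h).mpr hj)]
  · rw [walkStep_of_floor_odd hj, walkStep_of_floor_odd ((Int.even_sub'.mp h).mpr hj)]

theorem walkStep_neg {x : ℝ} {i j : ℕ} (h : Odd (⌊(i : ℝ) * x⌋ - ⌊(j : ℝ) * x⌋)) :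
    walkStep x i = -walkStep x j := by
  rcases Int.even_or_odd ⌊(j : ℝ) * x⌋ with hj | hj
  · rw [walkStep_of_floor_even hj, walkStep_of_floor_odd ((Int.odd_sub.mp h).mpr hj)]
  · rw [walkStep_of_floor_odd hj, walkStep_of_floor_even ((Int.odd_sub'.mp h).mp hj)]; rfl

/-! ### Consequences of the BR condition -/

theorem even_convDenom_odd {ξ : ℝ} (h : IsBR ξ) (k : ℕ) : Even (convDenom ξ (2 * k + 1)) :=
  (isBR_iff_even_convDenom ξ).mp h k

theorem odd_convDenom_even {ξ : ℝ} (h : IsBR ξ) (k : ℕ) : Odd (convDenom ξ (2 * k)) := by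
  have h1 := convNum_mul_convDenom_sub ξ (2 * k)
  have h2 : Odd (convNum ξ (2 * k + 1) * convDenom ξ (2 * k)) := by
    rw [sub_eq_iff_eq_add.mp h1, (even_two_mul k).neg_one_pow]
    exact odd_one.add_even ((even_convDenom_odd h k).mul_left _)
  exact (Int.odd_mul.mp h2).2

theorem odd_convNum_odd {ξ : ℝ} (h : IsBR ξ) (k : ℕ) : Odd (convNum ξ (2 * k + 1)) := by
  have h1 := convNum_mul_convDenom_sub ξ (2 * k)
  have h2 : Odd (convNum ξ (2 * k + 1) * convDenom ξ (2 * k)) := by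
    rw [sub_eq_iff_eq_add.mp h1, (even_two_mul k).neg_one_pow]
    exact odd_one.add_even ((even_convDenom_odd h k).mul_left _)
  exact (Int.odd_mul.mp h2).1

theorem convDenom_mul_even (ξ : ℝ) (k : ℕ) :
    (convDenom ξ (2 * k) : ℝ) * ξ = convNum ξ (2 * k) + convErr ξ (2 * k) := by
  simp [convErr]

theorem convDenom_mul_odd (ξ : ℝ) (k : ℕ) :
    (convDenom ξ (2 * k + 1) : ℝ) * ξ = convNum ξ (2 * k + 1) - convErr ξ (2 * k + 1) := by
  simp [convErr, pow_succ]

/-- Since `a_1` is even, `a_1 ≥ 2`, so `a_1 ξ < 1` gives `D_0 = ξ < 1/2`; the errors decrease from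
there. -/
theorem convErr_lt_half {ξ : ℝ} (hξ : Irrational ξ) (h0 : 0 < ξ) (h1 : ξ < 1) (hBR : IsBR ξ)
    (n : ℕ) : convErr ξ n < 1 / 2 := by
  induction n with
  | zero =>
    have h := convErr_pos hξ h0 h1 1
    have h2 := one_le_partialQuotient hξ 0
    obtain ⟨c, hc⟩ := hBR 0
    have h3 : (2 : ℝ) ≤ partialQuotient ξ 1 := by
      have : (2 : ℤ) ≤ partialQuotient ξ 1 := by simp only [mul_zero, zero_add] at hc h2; omega
      exact_mod_cast this
    simp only [convErr, convDenom, convNum] at h ⊢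
    push_cast at h ⊢
    nlinarith
  | succ n ih => exact (convErr_succ_lt hξ h0 h1 n).trans ih


/-! ### Symmetries of the increments -/

/-- The shift adds `2 p_{2k} + 2 D_{2k}` to `2jξ`. Parity could change only if an integer lay within
`2 D_{2k}` above `2jξ`; the convergent coordinates of that pair exclude this. -/
theorem walkStep_add_even {ξ : ℝ} (hξ : Irrational ξ) (h0 : 0 < ξ) (h1 : ξ < 1) (hBR : IsBR ξ)
    {k q j : ℕ} (hq : (q : ℤ) = convDenom ξ (2 * k)) (hj1 : 1 ≤ j)
    (hj : 2 * (j : ℤ) < convDenom ξ (2 * k + 1)) :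
    walkStep (2 * ξ) (j + q) = walkStep (2 * ξ) j := by
  have hD := convErr_pos hξ h0 h1 (2 * k)
  have hD' := convErr_pos hξ h0 h1 (2 * k + 1)
  have hqξ := convDenom_mul_even ξ k
  have hqpos := convDenom_pos hξ (2 * k)
  have hQpos := convDenom_pos hξ (2 * k + 1)
  have hqR : (q : ℝ) = convDenom ξ (2 * k) := by exact_mod_cast hq
  apply walkStep_congr
  have hfl : ⌊((j + q : ℕ) : ℝ) * (2 * ξ)⌋ = 2 * convNum ξ (2 * k) + ⌊(j : ℝ) * (2 * ξ)⌋ := by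
    rw [Int.floor_eq_iff]
    have hl := Int.floor_le ((j : ℝ) * (2 * ξ))
    have hu := Int.lt_floor_add_one ((j : ℝ) * (2 * ξ))
    push_cast
    have e : ((j : ℝ) + q) * (2 * ξ) = j * (2 * ξ) + 2 * convNum ξ (2 * k)
        + 2 * convErr ξ (2 * k) := by rw [hqR]; linarith
    rw [e]
    refine ⟨by linarith, ?_⟩
    by_contra hcon
    push Not at hcon
    obtain ⟨u, v, hi, hv⟩ := exists_convergent_coords ξ (2 * k) (2 * j) (⌊(j : ℝ) * (2 * ξ)⌋ + 1)
    rw [(even_two_mul k).neg_one_pow] at hv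
    push_cast at hv
    -- Evenness excludes `u = -1`, the value that the error bound alone would permit.
    have hu_even : Even u := by
      have h2 : Even (u * convDenom ξ (2 * k)) := by
        rw [show u * convDenom ξ (2 * k) = 2 * j - v * convDenom ξ (2 * k + 1) by linarith]
        exact (even_two_mul _).sub ((even_convDenom_odd hBR k).mul_left _)
      exact (Int.even_mul.mp h2).resolve_right (Int.not_even_iff_odd.mpr (odd_convDenom_even hBR k))
    have hlo : -(2 * convErr ξ (2 * k)) ≤ u * convErr ξ (2 * k) - v * convErr ξ (2 * k + 1) := by
      linarith
    have hhi : u * convErr ξ (2 * k) - v * convErr ξ (2 * k + 1) < 0 := by linarith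
    rcases lt_trichotomy u 0 with hu0 | hu0 | hu0
    · have hu2 : u ≤ -2 := by obtain ⟨c, rfl⟩ := hu_even; omega
      have hv1 : 1 ≤ v := by
        by_contra hc
        have : v ≤ 0 := by omega
        nlinarith
      have : (u : ℝ) ≤ -2 := by exact_mod_cast hu2
      have : (1 : ℝ) ≤ v := by exact_mod_cast hv1
      nlinarith
    · subst hu0
      have hv1 : 1 ≤ v := by
        by_contra hc
        have : v ≤ 0 := by omega
        nlinarith
      nlinarith
    · have hv1 : 1 ≤ v := by
        by_contra hc
        have h3 : v ≤ 0 := by omega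
        have : (v : ℝ) ≤ 0 := by exact_mod_cast h3
        have : (0 : ℝ) < u := by exact_mod_cast hu0
        nlinarith
      nlinarith
  rw [hfl]
  simp

theorem even_right_coord {ξ : ℝ} (hBR : IsBR ξ) {k : ℕ} {i u v : ℤ}
    (h : 2 * i = u * convDenom ξ (2 * k + 1) + v * convDenom ξ (2 * k + 1 + 1)) : Even v := by
  have h2 : Even (v * convDenom ξ (2 * k + 1 + 1)) := by
    rw [show v * convDenom ξ (2 * k + 1 + 1) = 2 * i - u * convDenom ξ (2 * k + 1) by linarith]
    exact (even_two_mul _).sub ((even_convDenom_odd hBR k).mul_left _)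
  exact (Int.even_mul.mp h2).resolve_right
    (Int.not_even_iff_odd.mpr (odd_convDenom_even hBR (k + 1)))

/-- Now the shift lowers `2jξ` by `2 D_{2k+1}` modulo 2, so an integer at most `2jξ` and less than
`2 D_{2k+1}` away must be excluded. -/
theorem walkStep_add_odd {ξ : ℝ} (hξ : Irrational ξ) (h0 : 0 < ξ) (h1 : ξ < 1) (hBR : IsBR ξ)
    {k q j : ℕ} (hq : (q : ℤ) = convDenom ξ (2 * k + 1)) (hj1 : 1 ≤ j)
    (hj : (j : ℤ) + q ≤ convDenom ξ (2 * k + 2)) :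
    walkStep (2 * ξ) (j + q) = walkStep (2 * ξ) j := by
  have hD := convErr_pos hξ h0 h1 (2 * k + 1)
  have hD' := convErr_pos hξ h0 h1 (2 * k + 1 + 1)
  have hqξ := convDenom_mul_odd ξ k
  have hqpos := convDenom_pos hξ (2 * k + 1)
  have hQpos := convDenom_pos hξ (2 * k + 1 + 1)
  change _ ≤ convDenom ξ (2 * k + 1 + 1) at hj
  have hqR : (q : ℝ) = convDenom ξ (2 * k + 1) := by exact_mod_cast hq
  apply walkStep_congr
  have hfl : ⌊((j + q : ℕ) : ℝ) * (2 * ξ)⌋ =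
      2 * convNum ξ (2 * k + 1) + ⌊(j : ℝ) * (2 * ξ)⌋ := by
    rw [Int.floor_eq_iff]
    have hl := Int.floor_le ((j : ℝ) * (2 * ξ))
    have hu := Int.lt_floor_add_one ((j : ℝ) * (2 * ξ))
    push_cast
    have e : ((j : ℝ) + q) * (2 * ξ) = j * (2 * ξ) + 2 * convNum ξ (2 * k + 1)
        - 2 * convErr ξ (2 * k + 1) := by rw [hqR]; linarith
    rw [e]
    refine ⟨?_, by linarith⟩
    by_contra hcon
    push Not at hcon
    obtain ⟨u, v, hi, hv⟩ := exists_convergent_coords ξ (2 * k + 1) (2 * j) ⌊(j : ℝ) * (2 * ξ)⌋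
    rw [(odd_two_mul_add_one k).neg_one_pow] at hv
    push_cast at hv
    have hve := even_right_coord hBR hi
    have hlo : 0 ≤ v * convErr ξ (2 * k + 1 + 1) - u * convErr ξ (2 * k + 1) := by linarith
    have hhi : v * convErr ξ (2 * k + 1 + 1) - u * convErr ξ (2 * k + 1)
      < 2 * convErr ξ (2 * k + 1) := by linarith
    rw [hq] at hj
    rcases lt_trichotomy v 0 with hv0 | hv0 | hv0
    · have hu1 : 1 ≤ u := by
        by_contra hc
        have : u ≤ 0 := by omega
        nlinarith
      have : (v : ℝ) < 0 := by exact_mod_cast hv0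
      have : (1 : ℝ) ≤ u := by exact_mod_cast hu1
      nlinarith
    · subst hv0
      have hu1 : 1 ≤ u := by
        by_contra hc
        have : u ≤ 0 := by omega
        nlinarith
      have : (1 : ℝ) ≤ u := by exact_mod_cast hu1
      push_cast at hlo
      nlinarith
    -- For `u ≤ -2` the error is too large; for `u ≥ -1` one gets `2j ≥ 2 q_{2k+2} - q_{2k+1}`,
    -- against `hj`.
    · have hv2 : 2 ≤ v := by obtain ⟨c, rfl⟩ := hve; omega
      rcases le_or_gt u (-2) with hu2 | hu2
      · have : (u : ℝ) ≤ -2 := by exact_mod_cast hu2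
        have : (2 : ℝ) ≤ v := by exact_mod_cast hv2
        nlinarith
      · have : -1 ≤ u := by omega
        nlinarith
  rw [hfl]
  simp

/-- Here `2iξ = 2 p_{2k+1} - 2jξ - 2 D_{2k+1}`, so the floors have odd difference unless an integer
lies less than `2 D_{2k+1}` above `2jξ`. -/
theorem walkStep_reflect {ξ : ℝ} (hξ : Irrational ξ) (h0 : 0 < ξ) (h1 : ξ < 1) (hBR : IsBR ξ)
    {k i j : ℕ} (hij : (i : ℤ) + j = convDenom ξ (2 * k + 1)) (hj1 : 1 ≤ j) (hj : j < i) :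
    walkStep (2 * ξ) i = -walkStep (2 * ξ) j := by
  have hD := convErr_pos hξ h0 h1 (2 * k + 1)
  have hD' := convErr_pos hξ h0 h1 (2 * k + 1 + 1)
  have hqξ := convDenom_mul_odd ξ k
  have hqpos := convDenom_pos hξ (2 * k + 1)
  have hlt : convDenom ξ (2 * k + 1) < convDenom ξ (2 * k + 1 + 1) := by
    have h2 := one_le_partialQuotient hξ (2 * k + 1)
    have h3 := convDenom_pos hξ (2 * k)
    have h4 : convDenom ξ (2 * k + 1 + 1) =
      partialQuotient ξ (2 * k + 2) * convDenom ξ (2 * k + 1) + convDenom ξ (2 * k) := rfl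
    nlinarith
  have hijR : (i : ℝ) = convDenom ξ (2 * k + 1) - j := by
    rw [eq_sub_iff_add_eq]; exact_mod_cast hij
  apply walkStep_neg
  have hfl : ⌊(i : ℝ) * (2 * ξ)⌋ = 2 * convNum ξ (2 * k + 1) - ⌊(j : ℝ) * (2 * ξ)⌋ - 1 := by
    rw [Int.floor_eq_iff]
    have hl := Int.floor_le ((j : ℝ) * (2 * ξ))
    have hu := Int.lt_floor_add_one ((j : ℝ) * (2 * ξ))
    push_cast
    have e : (i : ℝ) * (2 * ξ) = 2 * convNum ξ (2 * k + 1) - j * (2 * ξ)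
        - 2 * convErr ξ (2 * k + 1) := by rw [hijR]; linarith
    rw [e]
    refine ⟨?_, by linarith⟩
    by_contra hcon
    push Not at hcon
    obtain ⟨u, v, hi, hv⟩ :=
      exists_convergent_coords ξ (2 * k + 1) (2 * j) (⌊(j : ℝ) * (2 * ξ)⌋ + 1)
    rw [(odd_two_mul_add_one k).neg_one_pow] at hv
    push_cast at hv
    have hve := even_right_coord hBR hi
    have hlo : -(2 * convErr ξ (2 * k + 1)) <
      v * convErr ξ (2 * k + 1 + 1) - u * convErr ξ (2 * k + 1) := by linarith
    have hhi : v * convErr ξ (2 * k + 1 + 1) - u * convErr ξ (2 * k + 1) < 0 := by linarith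
    have hjQ : 2 * (j : ℤ) < convDenom ξ (2 * k + 1) := by omega
    rcases lt_trichotomy v 0 with hv0 | hv0 | hv0
    · have hv2 : v ≤ -2 := by obtain ⟨c, rfl⟩ := hve; omega
      -- Positivity of `2j` with `v ≤ -2` forces `u q_{2k+1} > 2 q_{2k+2} > 2 q_{2k+1}`.
      have hu1 : 3 ≤ u := by
        by_contra hc
        have : u ≤ 2 := by omega
        nlinarith
      have : (v : ℝ) < 0 := by exact_mod_cast hv0
      have : (3 : ℝ) ≤ u := by exact_mod_cast hu1
      nlinarith
    · subst hv0
      rcases le_or_gt u 0 with hu1 | hu1 <;> nlinarith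
    · have hu1 : u ≤ -1 := by
        by_contra hc
        have : 0 ≤ u := by omega
        nlinarith
      have : (u : ℝ) ≤ -1 := by exact_mod_cast hu1
      have : (0 : ℝ) < v := by exact_mod_cast hv0
      nlinarith
  rw [hfl]
  exact ⟨convNum ξ (2 * k + 1) - ⌊(j : ℝ) * (2 * ξ)⌋ - 1, by ring⟩

theorem walkStep_half_convDenom {ξ : ℝ} (hξ : Irrational ξ) (h0 : 0 < ξ) (h1 : ξ < 1)
    (hBR : IsBR ξ) {k h : ℕ} (hh : 2 * (h : ℤ) = convDenom ξ (2 * k + 1)) :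
    walkStep (2 * ξ) h = 1 := by
  have hD := convErr_pos hξ h0 h1 (2 * k + 1)
  have hD' := convErr_lt_half hξ h0 h1 hBR (2 * k + 1)
  have hqξ := convDenom_mul_odd ξ k
  have hR : 2 * (h : ℝ) = convDenom ξ (2 * k + 1) := by exact_mod_cast hh
  apply walkStep_of_floor_even
  have : ⌊(h : ℝ) * (2 * ξ)⌋ = convNum ξ (2 * k + 1) - 1 := by
    rw [Int.floor_eq_iff, show (h : ℝ) * (2 * ξ) = 2 * h * ξ by ring, hR, hqξ]
    push_cast
    constructor <;> linarith
  rw [this]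
  exact (odd_convNum_odd hBR k).sub_odd odd_one

theorem walkStep_convDenom_odd {ξ : ℝ} (hξ : Irrational ξ) (h0 : 0 < ξ) (h1 : ξ < 1)
    (hBR : IsBR ξ) {k q : ℕ} (hq : (q : ℤ) = convDenom ξ (2 * k + 1)) :
    walkStep (2 * ξ) q = -1 := by
  have hD := convErr_pos hξ h0 h1 (2 * k + 1)
  have hD' := convErr_lt_half hξ h0 h1 hBR (2 * k + 1)
  have hqξ := convDenom_mul_odd ξ k
  have hR : (q : ℝ) = convDenom ξ (2 * k + 1) := by exact_mod_cast hq
  apply walkStep_of_floor_odd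
  have : ⌊(q : ℝ) * (2 * ξ)⌋ = 2 * convNum ξ (2 * k + 1) - 1 := by
    rw [Int.floor_eq_iff, show (q : ℝ) * (2 * ξ) = 2 * (q * ξ) by ring, hR, hqξ]
    push_cast
    constructor <;> linarith
  rw [this]
  exact (even_two_mul _).sub_odd odd_one

/-! ### Half quotients and half denominators -/

/-- Half of the odd partial quotient `a_{2k+1}`. -/
noncomputable def halfQuotient (ξ : ℝ) (k : ℕ) : ℕ := (partialQuotient ξ (2 * k + 1) / 2).toNat

theorem two_mul_halfQuotient {ξ : ℝ} (hξ : Irrational ξ) (hBR : IsBR ξ) (k : ℕ) :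
    2 * (halfQuotient ξ k : ℤ) = partialQuotient ξ (2 * k + 1) := by
  have h1 := one_le_partialQuotient hξ (2 * k)
  obtain ⟨c, hc⟩ := hBR k
  simp only [halfQuotient]
  omega

theorem one_le_halfQuotient {ξ : ℝ} (hξ : Irrational ξ) (hBR : IsBR ξ) (k : ℕ) :
    1 ≤ halfQuotient ξ k := by
  have h1 := one_le_partialQuotient hξ (2 * k)
  have h2 := two_mul_halfQuotient hξ hBR k
  omega

/-- The denominators `q_n` as natural numbers. -/
noncomputable def natDenom (ξ : ℝ) (n : ℕ) : ℕ := (convDenom ξ n).toNat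

theorem natDenom_cast {ξ : ℝ} (hξ : Irrational ξ) (n : ℕ) :
    (natDenom ξ n : ℤ) = convDenom ξ n :=
  Int.toNat_of_nonneg (by linarith [convDenom_pos hξ n])

theorem natDenom_pos {ξ : ℝ} (hξ : Irrational ξ) (n : ℕ) : 1 ≤ natDenom ξ n := by
  have := convDenom_pos hξ n
  rw [← natDenom_cast hξ] at this
  exact_mod_cast this

theorem convDenom_mono {ξ : ℝ} (hξ : Irrational ξ) : Monotone (convDenom ξ) := by
  refine monotone_nat_of_le_succ fun n => ?_
  cases n with
  | zero => exact one_le_partialQuotient hξ 0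
  | succ m =>
    have h1 := one_le_partialQuotient hξ (m + 1)
    have h2 := convDenom_pos hξ m
    have h3 := convDenom_pos hξ (m + 1)
    have h4 : convDenom ξ (m + 1 + 1) =
      partialQuotient ξ (m + 2) * convDenom ξ (m + 1) + convDenom ξ m := rfl
    nlinarith

/-- `q_{2k-1} / 2`, with `q_{-1} = 0`. -/
noncomputable def halfDenom (ξ : ℝ) (k : ℕ) : ℕ :=
  ∑ i ∈ Finset.range k, halfQuotient ξ i * natDenom ξ (2 * i)

/-- The value `∑_{i<k} a_{2i+1} / 2` of the walk at `q_{2k-1} / 2`. -/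
noncomputable def halfQuotientSum (ξ : ℝ) (k : ℕ) : ℕ :=
  ∑ i ∈ Finset.range k, halfQuotient ξ i

theorem halfDenom_succ (ξ : ℝ) (k : ℕ) :
    halfDenom ξ (k + 1) = halfDenom ξ k + halfQuotient ξ k * natDenom ξ (2 * k) :=
  Finset.sum_range_succ _ _

theorem halfQuotientSum_succ (ξ : ℝ) (k : ℕ) :
    halfQuotientSum ξ (k + 1) = halfQuotientSum ξ k + halfQuotient ξ k :=
  Finset.sum_range_succ _ _

/-- The recurrence `q_{2k+1} - q_{2k-1} = a_{2k+1} q_{2k}` telescopes. -/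
theorem two_mul_halfDenom_succ {ξ : ℝ} (hξ : Irrational ξ) (hBR : IsBR ξ) (k : ℕ) :
    2 * (halfDenom ξ (k + 1) : ℤ) = convDenom ξ (2 * k + 1) := by
  induction k with
  | zero =>
    have h := two_mul_halfQuotient hξ hBR 0
    have h1 := natDenom_cast hξ 0
    simp only [convDenom, mul_zero, zero_add] at h h1 ⊢
    simp [halfDenom, h, h1]
  | succ k ih =>
    have h4 : convDenom ξ (2 * (k + 1) + 1) = partialQuotient ξ (2 * (k + 1) + 1) *
      convDenom ξ (2 * (k + 1)) + convDenom ξ (2 * k + 1) := rfl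
    rw [halfDenom_succ, h4, ← ih, ← two_mul_halfQuotient hξ hBR, ← natDenom_cast hξ]
    push_cast
    ring

theorem halfDenom_lt {ξ : ℝ} (hξ : Irrational ξ) (hBR : IsBR ξ) (k : ℕ) :
    halfDenom ξ k < natDenom ξ (2 * k) := by
  cases k with
  | zero => simpa [halfDenom] using Nat.lt_of_lt_of_le one_pos (natDenom_pos hξ 0)
  | succ k =>
    have h1 := two_mul_halfDenom_succ hξ hBR k
    have h2 := convDenom_mono hξ (show 2 * k + 1 ≤ 2 * (k + 1) by omega)
    have h3 := natDenom_cast hξ (2 * (k + 1))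
    have h4 := convDenom_pos hξ (2 * (k + 1))
    omega

/-! ### Symmetries and special values of the walk -/

/-- Increments at mirror positions about `h` cancel; the 1 is the unpaired increment at `h` itself.
-/
theorem walk_reflect {ξ : ℝ} (hξ : Irrational ξ) (h0 : 0 < ξ) (h1 : ξ < 1) (hBR : IsBR ξ)
    {k h : ℕ} (hh : 2 * (h : ℤ) = convDenom ξ (2 * k + 1)) (t : ℕ) (ht : t < h) :
    walk (2 * ξ) (h + t) = 1 + walk (2 * ξ) (h - 1 - t) := by
  induction t with
  | zero =>
    have h2 := walk_succ (2 * ξ) (h - 1)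
    rw [Nat.sub_add_cancel (by omega), walkStep_half_convDenom hξ h0 h1 hBR hh] at h2
    rw [add_zero, h2, Nat.sub_zero, add_comm]
  | succ t ih =>
    have h2 := walk_succ (2 * ξ) (h - 1 - (t + 1))
    rw [show h - 1 - (t + 1) + 1 = h - 1 - t by omega] at h2
    rw [← add_assoc, walk_succ, ih (by omega), h2,
      walkStep_reflect hξ h0 h1 hBR (k := k) (i := h + t + 1) (j := h - 1 - t) (by omega)
        (by omega) (by omega)]
    ring

theorem walk_convDenom_odd {ξ : ℝ} (hξ : Irrational ξ) (h0 : 0 < ξ) (h1 : ξ < 1) (hBR : IsBR ξ)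
    (k : ℕ) : walk (2 * ξ) (natDenom ξ (2 * k + 1)) = 0 := by
  have hh := two_mul_halfDenom_succ hξ hBR k
  have hq := natDenom_cast hξ (2 * k + 1)
  have hpos := natDenom_pos hξ (2 * k + 1)
  have h2 := walk_reflect hξ h0 h1 hBR hh (halfDenom ξ (k + 1) - 1) (by omega)
  have h3 := walk_succ (2 * ξ) (halfDenom ξ (k + 1) + (halfDenom ξ (k + 1) - 1))
  rw [show halfDenom ξ (k + 1) + (halfDenom ξ (k + 1) - 1) + 1 = natDenom ξ (2 * k + 1) by omega,
    h2, walkStep_convDenom_odd hξ h0 h1 hBR hq, Nat.sub_self, walk_zero] at h3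
  rw [h3]
  rfl

theorem natDenom_add_two {ξ : ℝ} (hξ : Irrational ξ) (n : ℕ) : ∃ a, 1 ≤ a ∧
    natDenom ξ (n + 2) = a * natDenom ξ (n + 1) + natDenom ξ n := by
  have h1 : 1 ≤ partialQuotient ξ (n + 2) := one_le_partialQuotient hξ (n + 1)
  refine ⟨(partialQuotient ξ (n + 2)).toNat, by omega, ?_⟩
  zify
  rw [Int.toNat_of_nonneg (by omega), natDenom_cast hξ, natDenom_cast hξ, natDenom_cast hξ]
  rfl

theorem walk_add_natDenom_odd {ξ : ℝ} (hξ : Irrational ξ) (h0 : 0 < ξ) (h1 : ξ < 1)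
    (hBR : IsBR ξ) {k m : ℕ} (hm : m + natDenom ξ (2 * k + 1) ≤ natDenom ξ (2 * k + 2)) :
    walk (2 * ξ) (m + natDenom ξ (2 * k + 1)) = walk (2 * ξ) m := by
  have h3 := natDenom_cast hξ (2 * k + 1)
  have h4 := natDenom_cast hξ (2 * k + 2)
  rw [walk_add fun j hj1 hj => walkStep_add_odd hξ h0 h1 hBR h3 hj1 (by omega),
    walk_convDenom_odd hξ h0 h1 hBR, add_zero]

theorem walk_convDenom_even {ξ : ℝ} (hξ : Irrational ξ) (h0 : 0 < ξ) (h1 : ξ < 1) (hBR : IsBR ξ)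
    (k : ℕ) : walk (2 * ξ) (natDenom ξ (2 * k)) = 1 := by
  induction k with
  | zero =>
    have h3 := convErr_lt_half hξ h0 h1 hBR 0
    simp only [convErr, convDenom, convNum] at h3
    push_cast at h3
    have h4 : natDenom ξ (2 * 0) = 0 + 1 := rfl
    rw [h4, walk_succ, walk_zero, walkStep_of_floor_even]
    · rfl
    · have : ⌊((0 + 1 : ℕ) : ℝ) * (2 * ξ)⌋ = 0 := by
        rw [Int.floor_eq_iff]
        push_cast
        constructor <;> linarith
      rw [this]
      exact Even.zero
  | succ k ih =>
    obtain ⟨a, ha, hq⟩ := natDenom_add_two hξ (2 * k)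
    rw [show 2 * (k + 1) = 2 * k + 2 by ring, hq, add_comm]
    -- Go from `q_{2k}` to `q_{2k+2}` in `a` shifts by `q_{2k+1}`, none of which changes the walk.
    have : ∀ b ≤ a, walk (2 * ξ) (natDenom ξ (2 * k) + b * natDenom ξ (2 * k + 1)) = 1 := by
      intro b hb
      induction b with
      | zero => simpa using ih
      | succ b ih2 =>
        rw [add_mul, one_mul, ← add_assoc, walk_add_natDenom_odd hξ h0 h1 hBR, ih2 (by omega)]
        rw [hq]
        nlinarith [Nat.mul_le_mul_right (natDenom ξ (2 * k + 1)) hb]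
    exact this a le_rfl

theorem walk_add_mul_natDenom_even {ξ : ℝ} (hξ : Irrational ξ) (h0 : 0 < ξ) (h1 : ξ < 1)
    (hBR : IsBR ξ) {k r b : ℕ} (h : r + b * natDenom ξ (2 * k) ≤ halfDenom ξ (k + 1)) :
    walk (2 * ξ) (r + b * natDenom ξ (2 * k)) = b + walk (2 * ξ) r := by
  induction b with
  | zero => simp
  | succ b ih =>
    have hpos := natDenom_pos hξ (2 * k)
    have hh := two_mul_halfDenom_succ hξ hBR k
    rw [add_mul, one_mul, ← add_assoc] at h ⊢
    rw [walk_add, walk_convDenom_even hξ h0 h1 hBR, ih (by omega)]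
    · push_cast
      ring
    · intro j hj1 hj
      exact walkStep_add_even hξ h0 h1 hBR (natDenom_cast hξ _) hj1 (by omega)

/-! ### Range of the walk and first passages -/

/-- The walk up to `q_{2k}`. -/
structure WalkBounds (ξ : ℝ) (k : ℕ) : Prop where
  nonneg : ∀ m < natDenom ξ (2 * k), 0 ≤ walk (2 * ξ) m
  le : ∀ m < natDenom ξ (2 * k), walk (2 * ξ) m ≤ halfQuotientSum ξ k
  lt : ∀ m < halfDenom ξ k, walk (2 * ξ) m < halfQuotientSum ξ k
  eq : walk (2 * ξ) (halfDenom ξ k) = halfQuotientSum ξ k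

theorem halfDenom_add_mul_le {ξ : ℝ} {k b : ℕ} (hb : b ≤ halfQuotient ξ k) :
    halfDenom ξ k + b * natDenom ξ (2 * k) ≤ halfDenom ξ (k + 1) := by
  rw [halfDenom_succ]
  gcongr

theorem WalkBounds.eq_add {ξ : ℝ} {k : ℕ} (H : WalkBounds ξ k) (hξ : Irrational ξ) (h0 : 0 < ξ)
    (h1 : ξ < 1) (hBR : IsBR ξ) {b : ℕ} (hb : b ≤ halfQuotient ξ k) :
    walk (2 * ξ) (halfDenom ξ k + b * natDenom ξ (2 * k)) = (halfQuotientSum ξ k + b : ℕ) := by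
  rw [walk_add_mul_natDenom_even hξ h0 h1 hBR (halfDenom_add_mul_le hb), H.eq]
  push_cast
  ring

/-- Writing `m = r + c q_{2k}` with `r < q_{2k}`, the walk at `m` is `c` plus its value at `r`. For
`c < b` the weak bound at `r` suffices; for `c = b`, `r` lies below `halfDenom ξ k` and the strict
bound applies. -/
theorem WalkBounds.lt_add {ξ : ℝ} {k : ℕ} (H : WalkBounds ξ k) (hξ : Irrational ξ) (h0 : 0 < ξ)
    (h1 : ξ < 1) (hBR : IsBR ξ) {b : ℕ} (hb : b ≤ halfQuotient ξ k) {m : ℕ}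
    (hm : m < halfDenom ξ k + b * natDenom ξ (2 * k)) :
    0 ≤ walk (2 * ξ) m ∧ walk (2 * ξ) m < (halfQuotientSum ξ k + b : ℕ) := by
  have hle := halfDenom_add_mul_le hb
  have hlt := halfDenom_lt hξ hBR k
  have hpos := natDenom_pos hξ (2 * k)
  have hr := Nat.mod_lt m hpos
  have hdm := Nat.mod_add_div' m (natDenom ξ (2 * k))
  generalize m % natDenom ξ (2 * k) = r at hr hdm
  generalize m / natDenom ξ (2 * k) = c at hdm
  subst hdm
  rw [walk_add_mul_natDenom_even hξ h0 h1 hBR (by omega)]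
  have hcb : c ≤ b := by
    by_contra hc
    have := Nat.mul_le_mul_right (natDenom ξ (2 * k)) (show b + 1 ≤ c by omega)
    rw [add_mul, one_mul] at this
    omega
  have hn := H.nonneg r hr
  have hl := H.le r hr
  push_cast
  refine ⟨by omega, ?_⟩
  rcases hcb.lt_or_eq with h | rfl
  · omega
  · have := H.lt r (by omega)
    omega

theorem walkBounds {ξ : ℝ} (hξ : Irrational ξ) (h0 : 0 < ξ) (h1 : ξ < 1) (hBR : IsBR ξ)
    (k : ℕ) : WalkBounds ξ k := by
  induction k with
  | zero =>
    have h4 : natDenom ξ (2 * 0) = 1 := rfl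
    have h5 : ∀ m < natDenom ξ (2 * 0), m = 0 := by omega
    constructor
    · intro m hm; rw [h5 m hm, walk_zero]
    · intro m hm; rw [h5 m hm, walk_zero]; simp
    · simp [halfDenom]
    · simp [halfDenom, halfQuotientSum, walk_zero]
  | succ k ih =>
    have hh := two_mul_halfDenom_succ hξ hBR k
    have hq := natDenom_cast hξ (2 * k + 1)
    have hpos := natDenom_pos hξ (2 * k + 1)
    have heq := ih.eq_add hξ h0 h1 hBR le_rfl
    rw [← halfDenom_succ, ← halfQuotientSum_succ] at heq
    have hlt : ∀ m < halfDenom ξ (k + 1), 0 ≤ walk (2 * ξ) m ∧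
        walk (2 * ξ) m < halfQuotientSum ξ (k + 1) := by
      intro m hm
      rw [halfDenom_succ] at hm
      rw [halfQuotientSum_succ]
      exact ih.lt_add hξ h0 h1 hBR le_rfl hm
    -- The half before `q_{2k+1}/2` is known, the other half is its mirror image, and beyond
    -- `q_{2k+1}` subtracting `q_{2k+1}` preserves the value.
    have key : ∀ m < natDenom ξ (2 * (k + 1)), 0 ≤ walk (2 * ξ) m ∧
        walk (2 * ξ) m ≤ halfQuotientSum ξ (k + 1) := by
      intro m
      induction m using Nat.strong_induction_on with
      | _ m ihm =>
        intro hm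
        rcases lt_or_ge m (natDenom ξ (2 * k + 1)) with h | h
        · rcases lt_or_ge m (halfDenom ξ (k + 1)) with h2 | h2
          · exact ⟨(hlt m h2).1, (hlt m h2).2.le⟩
          · obtain ⟨t, rfl⟩ := Nat.exists_eq_add_of_le h2
            rw [walk_reflect hξ h0 h1 hBR hh t (by omega)]
            have := hlt (halfDenom ξ (k + 1) - 1 - t) (by omega)
            omega
        · obtain ⟨t, rfl⟩ := Nat.exists_eq_add_of_le' h
          rw [walk_add_natDenom_odd hξ h0 h1 hBR hm.le]
          exact ihm t (by omega) (by omega)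
    exact ⟨fun m hm => (key m hm).1, fun m hm => (key m hm).2, fun m hm => (hlt m hm).2, heq⟩

/-! ### Classification of the records -/

/-- The condition `1 ≤ b ∨ k = 0` makes `b` an admissible leading digit. -/
theorem exists_halfQuotientSum_add {ξ : ℝ} (hξ : Irrational ξ) (hBR : IsBR ξ) (v : ℕ) :
    ∃ k b, b ≤ halfQuotient ξ k ∧ (1 ≤ b ∨ k = 0) ∧ halfQuotientSum ξ k + b = v := by
  induction v with
  | zero => exact ⟨0, 0, Nat.zero_le _, Or.inr rfl, by simp [halfQuotientSum]⟩
  | succ v ih =>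
    obtain ⟨k, b, hb, -, rfl⟩ := ih
    rcases hb.lt_or_eq with h | rfl
    · exact ⟨k, b + 1, h, Or.inl (by omega), by ring⟩
    · exact ⟨k + 1, 1, one_le_halfQuotient hξ hBR _, Or.inl le_rfl, by
        rw [halfQuotientSum_succ]⟩

theorem isRecord_halfDenom_add {ξ : ℝ} (hξ : Irrational ξ) (h0 : 0 < ξ) (h1 : ξ < 1)
    (hBR : IsBR ξ) {k b : ℕ} (hb : b ≤ halfQuotient ξ k) :
    IsRecord (2 * ξ) (halfDenom ξ k + b * natDenom ξ (2 * k)) := by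
  have H := walkBounds hξ h0 h1 hBR k
  intro m hm
  rw [H.eq_add hξ h0 h1 hBR hb]
  exact (H.lt_add hξ h0 h1 hBR hb hm).2.ne

/-- The value at `N` is nonnegative, hence first attained at a listed index; a record must be that
first passage. -/
theorem IsRecord.exists_eq {ξ : ℝ} (hξ : Irrational ξ) (h0 : 0 < ξ) (h1 : ξ < 1)
    (hBR : IsBR ξ) {N : ℕ} (hN : IsRecord (2 * ξ) N) :
    ∃ k b, b ≤ halfQuotient ξ k ∧ (1 ≤ b ∨ k = 0) ∧
      N = halfDenom ξ k + b * natDenom ξ (2 * k) := by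
  have hnn : 0 ≤ walk (2 * ξ) N := by
    -- The level `N + 1` is chosen so that `N < q_{2(N+1)}`.
    refine (walkBounds hξ h0 h1 hBR (N + 1)).nonneg N ?_
    have h2 := le_convDenom hξ (2 * N + 1)
    have h3 := natDenom_cast hξ (2 * (N + 1))
    rw [show 2 * N + 1 + 1 = 2 * (N + 1) by ring] at h2
    omega
  obtain ⟨v, hv⟩ := Int.eq_ofNat_of_zero_le hnn
  obtain ⟨k, b, hb, hb1, rfl⟩ := exists_halfQuotientSum_add hξ hBR v
  have H := walkBounds hξ h0 h1 hBR k
  refine ⟨k, b, hb, hb1, ?_⟩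
  rcases lt_trichotomy N (halfDenom ξ k + b * natDenom ξ (2 * k)) with h | h | h
  · exact absurd hv (H.lt_add hξ h0 h1 hBR hb h).2.ne
  · exact h
  · exact absurd ((H.eq_add hξ h0 h1 hBR hb).trans hv.symm) (hN _ h)

/-! ### Uniqueness of Ostrowski representations -/

/-- A maximal digit forces the preceding one to vanish, so the remaining sum is bounded two levels
down; hence the two-step induction. -/
theorem IsOstrowskiRep.sum_lt {ξ : ℝ} (hξ : Irrational ξ) {N n : ℕ} {b : ℕ → ℕ}
    (h : IsOstrowskiRep ξ N n b) (m : ℕ) (hm : m ≤ n + 1) :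
    ∑ i ∈ Finset.range m, (b i : ℤ) * convDenom ξ i < convDenom ξ m := by
  induction m using Nat.twoStepInduction with
  | zero => simp [convDenom]
  | one => simpa [convDenom] using h.zero_lt
  | more m ih0 ih1 =>
    have hq : convDenom ξ (m + 2) =
      partialQuotient ξ (m + 2) * convDenom ξ (m + 1) + convDenom ξ m := rfl
    have hpos := convDenom_pos hξ m
    have hpos' := convDenom_pos hξ (m + 1)
    have hle : (b (m + 1) : ℤ) ≤ partialQuotient ξ (m + 2) :=
      h.digit_le (m + 1) (by omega) (by omega)
    rcases hle.lt_or_eq with hlt | heq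
    · rw [Finset.sum_range_succ, hq]
      have h1 := ih1 (by omega)
      have h2 := mul_le_mul_of_nonneg_right (Int.add_one_le_iff.mpr hlt)
        (show 0 ≤ convDenom ξ (m + 1) by omega)
      linarith
    · have h0 : b m = 0 := h.carry (m + 1) (by omega) (by omega) heq
      have h1 := ih0 (by omega)
      rw [Finset.sum_range_succ, Finset.sum_range_succ, h0, heq, hq]
      push_cast
      linarith

theorem IsOstrowskiRep.convDenom_le {ξ : ℝ} (hξ : Irrational ξ) {N n : ℕ} {b : ℕ → ℕ}
    (h : IsOstrowskiRep ξ N n b) (hn : 0 < n) : convDenom ξ n ≤ N := by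
  have h1 : (1 : ℤ) ≤ b n := by exact_mod_cast Nat.pos_of_ne_zero (h.lead_ne_zero hn)
  have h2 := convDenom_pos hξ n
  have h3 : 0 ≤ ∑ i ∈ Finset.range n, (b i : ℤ) * convDenom ξ i :=
    Finset.sum_nonneg fun i _ => mul_nonneg (by positivity) (by linarith [convDenom_pos hξ i])
  rw [h.sum_eq, Finset.sum_range_succ]
  nlinarith

theorem IsOstrowskiRep.index_le {ξ : ℝ} (hξ : Irrational ξ) {N n n' : ℕ} {b b' : ℕ → ℕ}
    (h : IsOstrowskiRep ξ N n b) (h' : IsOstrowskiRep ξ N n' b') : n ≤ n' := by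
  by_contra hlt
  have h1 := h'.sum_lt hξ (n' + 1) le_rfl
  rw [← h'.sum_eq] at h1
  have h2 := h.convDenom_le hξ (by omega)
  have h3 := convDenom_mono hξ (show n' + 1 ≤ n by omega)
  omega

/-- The lower digits sum to less than `q_m`, so the top digit is determined; then descend. -/
theorem IsOstrowskiRep.digit_eq {ξ : ℝ} (hξ : Irrational ξ) {N n : ℕ} {b b' : ℕ → ℕ}
    (h : IsOstrowskiRep ξ N n b) (h' : IsOstrowskiRep ξ N n b') : ∀ i ≤ n, b i = b' i := by
  have key : ∀ m ≤ n + 1, ∑ i ∈ Finset.range m, (b i : ℤ) * convDenom ξ i =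
      ∑ i ∈ Finset.range m, (b' i : ℤ) * convDenom ξ i → ∀ i < m, b i = b' i := by
    intro m
    induction m with
    | zero => intro _ _ i hi; omega
    | succ m ih =>
      intro hm hs
      have h1 := h.sum_lt hξ m (by omega)
      have h2 := h'.sum_lt hξ m (by omega)
      have nn : ∀ c : ℕ → ℕ, 0 ≤ ∑ i ∈ Finset.range m, (c i : ℤ) * convDenom ξ i := fun c =>
        Finset.sum_nonneg fun i _ => mul_nonneg (by positivity) (by linarith [convDenom_pos hξ i])
      have h3 := nn b
      have h4 := nn b'
      rw [Finset.sum_range_succ, Finset.sum_range_succ] at hs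
      have hq := convDenom_pos hξ m
      have heq : (b m : ℤ) = b' m := by
        rcases lt_trichotomy (b m : ℤ) (b' m) with hlt | heq | hlt
        · nlinarith
        · exact heq
        · nlinarith
      intro i hi
      rcases (Nat.lt_succ_iff.mp hi).lt_or_eq with hi' | rfl
      · exact ih (by omega) (by rw [heq] at hs; linarith) i hi'
      · exact_mod_cast heq
  intro i hi
  exact key (n + 1) le_rfl (h.sum_eq.symm.trans h'.sum_eq) i (by omega)

/-! ### Ostrowski digits of the records -/

/-- The digits of the record `q_{2k-1} / 2 + b q_{2k}`. -/
noncomputable def recordDigits (ξ : ℝ) (k b i : ℕ) : ℕ :=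
  if i = 2 * k then b else if Even i then halfQuotient ξ (i / 2) else 0

theorem sum_even_digits {ξ : ℝ} (hξ : Irrational ξ) {k : ℕ} {d : ℕ → ℕ}
    (hodd : ∀ i < 2 * k, Odd i → d i = 0) (heven : ∀ i < k, d (2 * i) = halfQuotient ξ i) :
    ∑ i ∈ Finset.range (2 * k), (d i : ℤ) * convDenom ξ i = halfDenom ξ k := by
  induction k with
  | zero => simp [halfDenom]
  | succ k ih =>
    rw [show 2 * (k + 1) = 2 * k + 1 + 1 by ring, Finset.sum_range_succ, Finset.sum_range_succ,
      ih (fun i hi => hodd i (by omega)) (fun i hi => heven i (by omega)), halfDenom_succ,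
      hodd (2 * k + 1) (by omega) (odd_two_mul_add_one k), heven k (by omega),
      ← natDenom_cast hξ (2 * k)]
    push_cast
    ring

/-- Every digit is strictly below its maximum, so the carry condition is vacuous. -/
theorem isOstrowskiRep_recordDigits {ξ : ℝ} (hξ : Irrational ξ) (hBR : IsBR ξ) {k b : ℕ}
    (hb : b ≤ halfQuotient ξ k) (hb1 : 1 ≤ b ∨ k = 0) :
    IsOstrowskiRep ξ (halfDenom ξ k + b * natDenom ξ (2 * k)) (2 * k) (recordDigits ξ k b) := by
  have hlt : ∀ i ≤ 2 * k, (recordDigits ξ k b i : ℤ) < partialQuotient ξ (i + 1) := by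
    intro i hi
    have hpos := one_le_partialQuotient hξ i
    have h1 := two_mul_halfQuotient hξ hBR (i / 2)
    simp only [recordDigits]
    split_ifs with h2 h3
    · subst h2
      rw [Nat.mul_div_cancel_left k two_pos] at h1
      omega
    · rw [Nat.two_mul_div_two_of_even h3] at h1
      omega
    · exact_mod_cast hpos
  refine ⟨hlt 0 (by omega), fun i _ hi => (hlt i hi).le, fun i _ hi h => absurd h (hlt i hi).ne,
    fun hk => ?_, ?_⟩
  · simp only [recordDigits, if_true]
    omega
  · rw [Finset.sum_range_succ, sum_even_digits hξ, ← natDenom_cast hξ (2 * k)]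
    · simp [recordDigits]
    · intro i hi ho
      simp [recordDigits, hi.ne, ho]
    · intro i hi
      simp [recordDigits, hi.ne]

end DetWalk

theorem mainTheorem3 (ξ : ℝ) (h_irr : Irrational ξ) (h_pos : 0 < ξ) (h_lt : ξ < 1)
    (h_BR : DetWalk.IsBR ξ) (N n : ℕ) (b : ℕ → ℕ) (h_rep : DetWalk.IsOstrowskiRep ξ N n b) :
    DetWalk.IsRecord (2 * ξ) N ↔
      Even n ∧
      (∀ i ≤ n, Odd i → b i = 0) ∧
      (∀ i < n, Even i → 2 * (b i : ℤ) = DetWalk.partialQuotient ξ (i + 1)) ∧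
      2 * (b n : ℤ) ≤ DetWalk.partialQuotient ξ (n + 1) := by
  constructor
  · intro hN
    obtain ⟨k, c, hc, hc1, rfl⟩ := hN.exists_eq h_irr h_pos h_lt h_BR
    have h_rep' := DetWalk.isOstrowskiRep_recordDigits h_irr h_BR hc hc1
    obtain rfl : n = 2 * k :=
      le_antisymm (h_rep.index_le h_irr h_rep') (h_rep'.index_le h_irr h_rep)
    have hd := h_rep.digit_eq h_irr h_rep'
    refine ⟨even_two_mul k, fun i hi ho => ?_, fun i hi he => ?_, ?_⟩
    · have hne : i ≠ 2 * k := fun h => Nat.not_even_iff_odd.mpr ho (h ▸ even_two_mul k)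
      simp [hd i hi, DetWalk.recordDigits, hne, ho]
    · have h1 := DetWalk.two_mul_halfQuotient h_irr h_BR (i / 2)
      rw [Nat.two_mul_div_two_of_even he] at h1
      simp [hd i hi.le, DetWalk.recordDigits, hi.ne, he, h1]
    · have h1 := DetWalk.two_mul_halfQuotient h_irr h_BR k
      rw [hd _ le_rfl, ← h1]
      simpa [DetWalk.recordDigits] using hc
  · rintro ⟨hn, hodd, heven, hlead⟩
    obtain ⟨k, rfl⟩ := hn.exists_two_nsmul
    simp only [smul_eq_mul] at *
    rw [← DetWalk.two_mul_halfQuotient h_irr h_BR k] at hlead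
    have hN := h_rep.sum_eq
    rw [Finset.sum_range_succ, DetWalk.sum_even_digits h_irr (fun i hi => hodd i hi.le),
      ← DetWalk.natDenom_cast h_irr] at hN
    · obtain rfl : N = DetWalk.halfDenom ξ k + b (2 * k) * DetWalk.natDenom ξ (2 * k) := by
        exact_mod_cast hN
      exact DetWalk.isRecord_halfDenom_add h_irr h_pos h_lt h_BR (by omega)
    · intro i hi
      have h1 := heven (2 * i) (by omega) (even_two_mul i)
      rw [← DetWalk.two_mul_halfQuotient h_irr h_BR i] at h1
      omega
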